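/- Let $d\ge 1$ and let $q_1,\dots,q_{d-1}$ be positive integers. Let $q_d\in\{1,2\}$, and put $Q=(q_1,\dots,q_{d-1},q_d)$ and $\tilde Q=(q_1,\dots,q_{d-1})$. For $P=(p_1,\dots,p_m)\in\mathbb Z_{>0}^m$, a potential $V:\mathbb Z^m\to\mathbb C$ is called $P\mathbb Z$-periodic if $V(n+k)=V(n)$ for all $n\in\mathbb Z^m$ and all $k\in P\mathbb Z=p_1\mathbb Z\oplus\cdots\oplus p_m\mathbb Z$. Let $(\Delta u)(n)=\sum_{|n'-n|_1=1}u(n')$ be the discrete Laplacian on $\mathbb Z^m$. For a $P\mathbb Z$-periodic potential $V$ and $z$ in the torus $\mathbb T^m=\{z\in\mathbb C^m: |z_j|=1 \text{ for all } j\}$, let $L_V(z)$ be the matrix of size $p_1\cdots p_m$ that represents $\Delta+V$ on the space of functions $u:\mathbb Z^m\to\mathbb C$ with $u(n+p_j\delta_j)=z_ju(n)$ for all $n\in\mathbb Z^m$ and all $j$ (where $\delta_j$ is the $j$-th standard basis vector), such a function being identified with its values on $\prod_j\{1,\dots,p_j\}$. Two $P\mathbb Z$-periodic potentials $V$ and $V'$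 are called Floquet isospectral if, for every $z\in\mathbb T^m$, the matrices $L_V(z)$ and $L_{V'}(z)$ have the same multiset of eigenvalues, counted with algebraic multiplicity. Then there exists a nonzero $Q\mathbb Z$-periodic potential $V:\mathbb Z^d\to\mathbb C$ that is Floquet isospectral to the zero potential $\mathbf 0$ if and only if there exists a nonzero $\tilde Q\mathbb Z$-periodic potential $W:\mathbb Z^{d-1}\to\mathbb C$ that is Floquet isospectral to $\mathbf 0$. -/

import Mathlib

noncomputable section

namespace FloquetZd

open Finset

/-- The discrete Laplacian on `ℤ^d`: the value at `n` is the sum of `u n'` over the `2d` points `n'`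
with `|n' - n|₁ = 1`, that is, over the points `n + δ_j` and `n - δ_j`. -/
def laplacian {d : ℕ} (u : (Fin d → ℤ) → ℂ) (n : Fin d → ℤ) : ℂ :=
  ∑ j : Fin d, (u (n + Pi.single j 1) + u (n - Pi.single j 1))

/-- The discrete Schrödinger operator `Δ + V`. -/
def schrodinger {d : ℕ} (V u : (Fin d → ℤ) → ℂ) (n : Fin d → ℤ) : ℂ :=
  laplacian u n + V n * u n

/-- `V` is periodic with respect to the lattice `Qℤ = q₁ℤ ⊕ ⋯ ⊕ q_dℤ`. -/
def IsPeriodic {d : ℕ} (Q : Fin d → ℕ) (V : (Fin d → ℤ) → ℂ) : Prop :=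
  ∀ n m : Fin d → ℤ, (∀ j, (Q j : ℤ) ∣ m j) → V (n + m) = V n

/-- The points of the fundamental domain `{1, …, q₁} × ⋯ × {1, …, q_d}` of `Qℤ`. -/
def point {d : ℕ} {Q : Fin d → ℕ} (a : ∀ j, Fin (Q j)) : Fin d → ℤ :=
  fun j => ((a j : ℕ) : ℤ) + 1

/-- The function on `ℤ^d` which is supported on `point a + Qℤ`, equals `1` at `point a`, and
satisfies the Floquet boundary condition `u (n + q_j δ_j) = z_j u n`. For `z` with nonzero entries
and positive periods, these functions form a basis of the space of all solutions of the Floquet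
boundary condition, and the coordinates of a solution are its values on the fundamental domain. -/
def floquetBasis {d : ℕ} (Q : Fin d → ℕ) (z : Fin d → ℂ) (a : ∀ j, Fin (Q j))
    (n : Fin d → ℤ) : ℂ :=
  if ∀ j, (Q j : ℤ) ∣ n j - point a j then ∏ j, z j ^ ((n j - point a j) / (Q j : ℤ)) else 0

/-- The Floquet matrix `L_V(z)`, of size `q₁ ⋯ q_d`: the matrix of `Δ + V` acting on the functions
that satisfy the Floquet boundary condition with multiplier `z`. -/
def floquetMatrix {d : ℕ} (Q : Fin d → ℕ) (V : (Fin d → ℤ) → ℂ) (z : Fin d → ℂ) :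
    Matrix (∀ j, Fin (Q j)) (∀ j, Fin (Q j)) ℂ :=
  Matrix.of fun a b => schrodinger V (floquetBasis Q z b) (point a)

/-- The multiset `σ_V(z)` of the eigenvalues of `L_V(z)`, with algebraic multiplicity. -/
def floquetSpectrum {d : ℕ} (Q : Fin d → ℕ) (V : (Fin d → ℤ) → ℂ) (z : Fin d → ℂ) :
    Multiset ℂ :=
  (floquetMatrix Q V z).charpoly.roots

/-- Floquet isospectrality of two `Qℤ`-periodic potentials: `σ_V(z) = σ_{V'}(z)` for all `z` in
the torus `𝕋^d`. -/
def FloquetIsospectral {d : ℕ} (Q : Fin d → ℕ) (V V' : (Fin d → ℤ) → ℂ) : Prop :=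
  ∀ z : Fin d → ℂ, (∀ j, ‖z j‖ = 1) → floquetSpectrum Q V z = floquetSpectrum Q V' z

end FloquetZd

end

/-! Cutting a potential along the last coordinate writes the Floquet matrix in blocks: slice
matrices on the diagonal, coupled by scalar blocks depending only on the last multiplier `w`. For
period 1 the coupling only shifts the spectrum. For period 2 and a potential constant in the last
coordinate, the characteristic function factors into two shifted copies of that of the slice
(`charFun_of_last_eq_two_of_const`), so extending `W` constantly preserves isospectrality to zero.

Conversely, for period 2 the coupling vanishes at `w = -1`, so the characteristic functions of the
two slices multiply to the square of the free one. That each slice is then isospectral to zero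
(`floquetIsospectral_zero_of_mul`) expresses irreducibility of the free Bloch variety. In the
quasimomentum `θ`, all free eigenvalues are translates of one analytic function `freeEigenvalue`.
The product vanishes along it, hence so does one factor; translating gives that factor every free
eigenvalue, and these are generically distinct. A slice on which `V` is nonzero is the required `W`.
-/

namespace FloquetZd

open Complex

/-! ### The characteristic function of the Floquet matrix -/

/-- The characteristic polynomial of the Floquet matrix, as a function. -/
noncomputable def charFun {d : ℕ} (Q : Fin d → ℕ) (V : (Fin d → ℤ) → ℂ) (z : Fin d → ℂ) (x : ℂ) : ℂ :=
  (Matrix.scalar _ x - floquetMatrix Q V z).det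

theorem charFun_eq_eval {d : ℕ} (Q : Fin d → ℕ) (V : (Fin d → ℤ) → ℂ) (z : Fin d → ℂ) (x : ℂ) :
    charFun Q V z x = (floquetMatrix Q V z).charpoly.eval x :=
  (Matrix.eval_charpoly _ _).symm

theorem floquetSpectrum_eq_iff {d : ℕ} {Q : Fin d → ℕ} {V V' : (Fin d → ℤ) → ℂ}
    {z : Fin d → ℂ} :
    floquetSpectrum Q V z = floquetSpectrum Q V' z ↔
      (floquetMatrix Q V z).charpoly = (floquetMatrix Q V' z).charpoly := by
  refine ⟨fun h => ?_, fun h => by simp only [floquetSpectrum, h]⟩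
  have key : ∀ U : (Fin d → ℤ) → ℂ, (floquetMatrix Q U z).charpoly =
      ((floquetSpectrum Q U z).map fun a => Polynomial.X - Polynomial.C a).prod := fun U =>
    (IsAlgClosed.splits _).eq_prod_roots_of_monic (Matrix.charpoly_monic _)
  rw [key V, key V', h]

theorem floquetIsospectral_iff {d : ℕ} {Q : Fin d → ℕ} {V V' : (Fin d → ℤ) → ℂ} :
    FloquetIsospectral Q V V' ↔
      ∀ z : Fin d → ℂ, (∀ j, ‖z j‖ = 1) → ∀ x, charFun Q V z x = charFun Q V' z x := by
  refine forall₂_congr fun z _ => ?_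
  rw [floquetSpectrum_eq_iff]
  refine ⟨fun h x => by rw [charFun_eq_eval, charFun_eq_eval, h], fun h => ?_⟩
  exact Polynomial.funext fun x => by rw [← charFun_eq_eval, ← charFun_eq_eval, h]

/-! ### Plane waves -/

/-- Only the `l` with `l + 1` congruent to `n` contributes. This is the one-dimensional expansion of
a plane wave in the Floquet basis. -/
theorem sum_quasiperiodic {r : ℕ} (hr : 0 < r) {ζ : ℂ} (hζ : ζ ≠ 0) (n : ℤ) :
    ∑ l : Fin r, ζ ^ (((l : ℕ) : ℤ) + 1) *
      (if (r : ℤ) ∣ n - (((l : ℕ) : ℤ) + 1) then (ζ ^ r) ^ ((n - (((l : ℕ) : ℤ) + 1)) / (r : ℤ))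
        else 0) = ζ ^ n := by
  have hr' : (0 : ℤ) < r := by exact_mod_cast hr
  have h0 := Int.emod_nonneg (n - 1) hr'.ne'
  have h1 := Int.emod_lt_of_pos (n - 1) hr'
  obtain ⟨l, hl⟩ : ∃ l : Fin r, ((l : ℕ) : ℤ) = (n - 1) % r :=
    ⟨⟨((n - 1) % r).toNat, by omega⟩, by simp [h0]⟩
  have hdvd : (r : ℤ) ∣ n - (((l : ℕ) : ℤ) + 1) :=
    ⟨(n - 1) / r, by have := Int.mul_ediv_add_emod (n - 1) r; rw [hl]; linarith⟩
  rw [Fintype.sum_eq_single l]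
  · rw [if_pos hdvd, ← zpow_natCast, ← zpow_mul, Int.mul_ediv_cancel' hdvd, ← zpow_add₀ hζ]
    congr 1
    ring
  · intro m hm
    rw [if_neg, mul_zero]
    intro hdvd'
    have h2 : (r : ℤ) ∣ ((l : ℕ) : ℤ) - ((m : ℕ) : ℤ) := by
      have := dvd_sub hdvd' hdvd
      ring_nf at this
      simpa [sub_eq_neg_add, add_comm] using this
    have h3 := Int.eq_zero_of_abs_lt_dvd h2 (by rw [abs_lt]; constructor <;> omega)
    exact hm (Fin.ext (by omega))

theorem floquetBasis_eq_prod {d : ℕ} (Q : Fin d → ℕ) (z : Fin d → ℂ) (a : ∀ j, Fin (Q j))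
    (n : Fin d → ℤ) : floquetBasis Q z a n =
      ∏ j, if (Q j : ℤ) ∣ n j - (((a j : ℕ) : ℤ) + 1)
        then z j ^ ((n j - (((a j : ℕ) : ℤ) + 1)) / (Q j : ℤ)) else 0 := by
  unfold floquetBasis point
  split_ifs with h
  · exact Finset.prod_congr rfl fun j _ => (if_pos (h j)).symm
  · push Not at h
    obtain ⟨j, hj⟩ := h
    exact (Finset.prod_eq_zero (Finset.mem_univ j) (if_neg hj)).symm

theorem sum_floquetBasis {d : ℕ} {Q : Fin d → ℕ} (hQ : ∀ j, 0 < Q j) {ζ : Fin d → ℂ}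
    (hζ : ∀ j, ζ j ≠ 0) (n : Fin d → ℤ) :
    ∑ b : (∀ j, Fin (Q j)), (∏ j, ζ j ^ point b j) * floquetBasis Q (fun j => ζ j ^ Q j) b n =
      ∏ j, ζ j ^ n j := by
  simp_rw [floquetBasis_eq_prod, ← Finset.prod_mul_distrib, point]
  rw [← Fintype.prod_sum (fun j (l : Fin (Q j)) => ζ j ^ (((l : ℕ) : ℤ) + 1) *
      (if (Q j : ℤ) ∣ n j - (((l : ℕ) : ℤ) + 1)
        then (ζ j ^ Q j) ^ ((n j - (((l : ℕ) : ℤ) + 1)) / (Q j : ℤ)) else 0))]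
  exact Finset.prod_congr rfl fun j _ => sum_quasiperiodic (hQ j) (hζ j) (n j)

theorem laplacian_planeWave {d : ℕ} {ζ : Fin d → ℂ} (hζ : ∀ j, ζ j ≠ 0) (n : Fin d → ℤ) :
    laplacian (fun n => ∏ j, ζ j ^ n j) n = (∑ j, (ζ j + (ζ j)⁻¹)) * ∏ j, ζ j ^ n j := by
  have h : ∀ (j : Fin d) (k : ℤ), ∏ i, ζ i ^ (Pi.single j k : Fin d → ℤ) i = ζ j ^ k := by
    intro j k
    rw [Fintype.prod_eq_single j, Pi.single_eq_same]
    intro i hi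
    rw [Pi.single_eq_of_ne hi, zpow_zero]
  rw [laplacian, Finset.sum_mul]
  refine Finset.sum_congr rfl fun j _ => ?_
  simp_rw [sub_eq_add_neg, ← Pi.single_neg, Pi.add_apply, zpow_add₀ (hζ _),
    Finset.prod_mul_distrib, h]
  rw [zpow_one, zpow_neg_one]
  ring

/-- The plane wave satisfies the Floquet condition with these multipliers, so its values on the
fundamental domain form an eigenvector. -/
theorem charFun_zero_eq_zero {d : ℕ} {Q : Fin d → ℕ} (hQ : ∀ j, 0 < Q j) {ζ : Fin d → ℂ}
    (hζ : ∀ j, ζ j ≠ 0) :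
    charFun Q 0 (fun j => ζ j ^ Q j) (∑ j, (ζ j + (ζ j)⁻¹)) = 0 := by
  refine Matrix.exists_mulVec_eq_zero_iff.1 ⟨fun b => ∏ j, ζ j ^ point b j, ?_, ?_⟩
  · intro h
    exact Finset.prod_ne_zero_iff.2 (fun j _ => zpow_ne_zero _ (hζ j))
      (congrFun h fun j => ⟨0, hQ j⟩)
  · ext a
    rw [Matrix.sub_mulVec, Pi.sub_apply, Matrix.scalar_apply, Matrix.mulVec_diagonal,
      ← laplacian_planeWave hζ, Pi.zero_apply, sub_eq_zero]
    have hsum : (fun n : Fin d → ℤ => ∏ j, ζ j ^ n j) = fun n => ∑ b : (∀ j, Fin (Q j)),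
        (∏ j, ζ j ^ point b j) * floquetBasis Q (fun j => ζ j ^ Q j) b n :=
      funext fun n => (sum_floquetBasis hQ hζ n).symm
    rw [hsum]
    simp only [Matrix.mulVec, dotProduct, floquetMatrix, Matrix.of_apply, schrodinger, laplacian,
      Pi.zero_apply, zero_mul, add_zero]
    simp_rw [← Finset.sum_add_distrib, ← mul_add]
    rw [Finset.sum_comm]
    refine Finset.sum_congr rfl fun b _ => ?_
    rw [← Finset.mul_sum, mul_comm]

/-! ### Dependence on the quasimomentum -/

/-- The Floquet multiplier `z_j = exp (i q_j θ_j)`. -/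
noncomputable def multiplier {d : ℕ} (Q : Fin d → ℕ) (θ : Fin d → ℝ) (j : Fin d) : ℂ :=
  exp (θ j * I) ^ Q j

/-- The eigenvalue of the free operator on the plane wave with frequency `θ`. -/
noncomputable def freeEigenvalue {d : ℕ} (θ : Fin d → ℝ) : ℂ :=
  ∑ j, (exp (θ j * I) + (exp (θ j * I))⁻¹)

theorem charFun_zero_freeEigenvalue {d : ℕ} {Q : Fin d → ℕ} (hQ : ∀ j, 0 < Q j)
    (θ : Fin d → ℝ) : charFun Q 0 (multiplier Q θ) (freeEigenvalue θ) = 0 :=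
  charFun_zero_eq_zero hQ fun _ => exp_ne_zero _

theorem exists_multiplier_eq {d : ℕ} {Q : Fin d → ℕ} (hQ : ∀ j, 0 < Q j) {z : Fin d → ℂ}
    (hz : ∀ j, ‖z j‖ = 1) : ∃ θ, multiplier Q θ = z := by
  refine ⟨fun j => (z j).arg / Q j, funext fun j => ?_⟩
  have h : (Q j : ℂ) ≠ 0 := by exact_mod_cast (hQ j).ne'
  rw [multiplier, ← exp_nat_mul]
  conv_rhs => rw [← norm_mul_exp_arg_mul_I (z j), hz j]
  push_cast
  rw [one_mul]
  congr 1
  field_simp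

/-- The frequency shifts that preserve the Floquet multipliers. -/
noncomputable def shift {d : ℕ} {Q : Fin d → ℕ} (a : ∀ j, Fin (Q j)) (j : Fin d) : ℝ :=
  2 * Real.pi * (a j : ℕ) / Q j

theorem multiplier_add_shift {d : ℕ} {Q : Fin d → ℕ} (hQ : ∀ j, 0 < Q j) (a : ∀ j, Fin (Q j))
    (θ : Fin d → ℝ) : multiplier Q (θ + shift a) = multiplier Q θ := by
  funext j
  have h : (Q j : ℂ) ≠ 0 := by exact_mod_cast (hQ j).ne'
  rw [multiplier, multiplier, ← exp_nat_mul, ← exp_nat_mul, exp_eq_exp_iff_exists_int]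
  refine ⟨(a j : ℕ), ?_⟩
  simp only [Pi.add_apply, shift]
  push_cast
  field_simp

theorem exp_shift_injective {d : ℕ} {Q : Fin d → ℕ} {a b : ∀ j, Fin (Q j)} {j : Fin d}
    (h : exp (shift a j * I) = exp (shift b j * I)) : a j = b j := by
  have hQ : 0 < Q j := (a j).pos
  have hp := isPrimitiveRoot_exp (Q j) hQ.ne'
  have key : ∀ c : ∀ j, Fin (Q j),
      exp (shift c j * I) = exp (2 * Real.pi * I / Q j) ^ (c j : ℕ) := by
    intro c
    rw [← exp_nat_mul, shift]
    push_cast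
    congr 1
    ring
  rw [key, key] at h
  exact Fin.ext (hp.pow_inj (a j).2 (b j).2 h)

/-- Moving only `θ j = t` leaves an expression `A e^{it} + B e^{-it}` constant in `t`; comparing `t
= 0, π, π/2` forces `A = B = 0`. -/
theorem exp_eq_of_freeEigenvalue_add_eq {d : ℕ} {α β : Fin d → ℝ}
    (h : ∀ θ, freeEigenvalue (θ + α) = freeEigenvalue (θ + β)) (j : Fin d) :
    exp (α j * I) = exp (β j * I) := by
  have h1 : ∀ t : ℝ, exp (t * I) * (exp (α j * I) - exp (β j * I)) +
      (exp (t * I))⁻¹ * ((exp (α j * I))⁻¹ - (exp (β j * I))⁻¹) =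
      (exp (α j * I) - exp (β j * I)) + ((exp (α j * I))⁻¹ - (exp (β j * I))⁻¹) := by
    intro t
    have ht := h (Pi.single j t)
    have h0 := h 0
    simp only [freeEigenvalue, zero_add] at ht h0
    rw [← Finset.add_sum_erase _ _ (Finset.mem_univ j),
      ← Finset.add_sum_erase _ _ (Finset.mem_univ j)] at ht h0
    have he : ∀ γ : Fin d → ℝ, ∑ i ∈ Finset.univ.erase j,
        (exp (((Pi.single j t + γ : Fin d → ℝ) i : ℝ) * I) +
          (exp (((Pi.single j t + γ : Fin d → ℝ) i : ℝ) * I))⁻¹) =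
        ∑ i ∈ Finset.univ.erase j, (exp (γ i * I) + (exp (γ i * I))⁻¹) := by
      intro γ
      refine Finset.sum_congr rfl fun i hi => ?_
      simp [Pi.single_eq_of_ne (Finset.ne_of_mem_erase hi)]
    rw [he, he] at ht
    simp only [Pi.add_apply, Pi.single_eq_same, ofReal_add, add_mul, exp_add, mul_inv] at ht
    linear_combination ht - h0
  have hpi := h1 Real.pi
  have hpi2 := h1 (Real.pi / 2)
  rw [exp_pi_mul_I] at hpi
  rw [ofReal_div, ofReal_ofNat, exp_pi_div_two_mul_I, inv_I] at hpi2
  have hs : (exp (α j * I) - exp (β j * I)) + ((exp (α j * I))⁻¹ - (exp (β j * I))⁻¹) = 0 := by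
    norm_num at hpi
    linear_combination (-1 / 2) * hpi
  have hd : (exp (α j * I) - exp (β j * I)) - ((exp (α j * I))⁻¹ - (exp (β j * I))⁻¹) = 0 :=
    mul_left_cancel₀ I_ne_zero (by linear_combination hpi2 + hs)
  exact sub_eq_zero.1 (by linear_combination (1 / 2) * hs + (1 / 2) * hd)

theorem exists_freeEigenvalue_ne {d : ℕ} {Q : Fin d → ℕ} {a b : ∀ j, Fin (Q j)} (hab : a ≠ b) :
    ∃ θ, freeEigenvalue (θ + shift a) ≠ freeEigenvalue (θ + shift b) := by
  by_contra! h
  exact hab (funext fun j => exp_shift_injective (exp_eq_of_freeEigenvalue_add_eq h j))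

/-! ### Analyticity -/

theorem analyticOnNhd_eq_zero_or_eq_zero {E : Type*} [NormedAddCommGroup E] [NormedSpace ℝ E]
    {f g : E → ℂ} (hf : AnalyticOnNhd ℝ f Set.univ) (hg : AnalyticOnNhd ℝ g Set.univ)
    (h : ∀ x, f x * g x = 0) : (∀ x, f x = 0) ∨ ∀ x, g x = 0 := by
  by_contra! hne
  obtain ⟨⟨x, hx⟩, y, hy⟩ := hne
  have hev : g =ᶠ[nhds x] 0 := by
    filter_upwards [(hf x trivial).continuousAt.eventually_ne hx] with u hu
    exact (mul_eq_zero.1 (h u)).resolve_left hu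
  exact hy (congrFun (hg.eq_of_eventuallyEq analyticOnNhd_const hev) y)

theorem analyticOnNhd_exp {d : ℕ} (j : Fin d) :
    AnalyticOnNhd ℝ (fun θ : Fin d → ℝ => exp (θ j * I)) Set.univ := by
  intro θ _
  have h1 : AnalyticAt ℝ (fun θ : Fin d → ℝ => (θ j : ℂ)) θ :=
    (ofRealCLM.comp (ContinuousLinearMap.proj (R := ℝ) (φ := fun _ : Fin d => ℝ) j)).analyticAt θ
  exact (analyticAt_cexp.restrictScalars (𝕜 := ℝ)).comp (h1.mul analyticAt_const)

theorem analyticOnNhd_freeEigenvalue {d : ℕ} :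
    AnalyticOnNhd ℝ (freeEigenvalue : (Fin d → ℝ) → ℂ) Set.univ := by
  intro θ _
  refine Finset.analyticAt_fun_sum _ fun j _ => ?_
  exact (analyticOnNhd_exp j θ trivial).add ((analyticOnNhd_exp j θ trivial).inv (exp_ne_zero _))

theorem analyticOnNhd_floquetMatrix {d : ℕ} (Q : Fin d → ℕ) (V : (Fin d → ℤ) → ℂ)
    (a b : ∀ j, Fin (Q j)) :
    AnalyticOnNhd ℝ (fun θ => floquetMatrix Q V (multiplier Q θ) a b) Set.univ := by
  have key : ∀ n, AnalyticOnNhd ℝ (fun θ => floquetBasis Q (multiplier Q θ) b n) Set.univ := by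
    intro n θ _
    unfold floquetBasis
    split_ifs
    · refine Finset.analyticAt_fun_prod _ fun j _ => ?_
      exact ((analyticOnNhd_exp j θ trivial).pow _).zpow (pow_ne_zero _ (exp_ne_zero _))
    · exact analyticAt_const
  intro θ _
  simp only [floquetMatrix, Matrix.of_apply, schrodinger, laplacian]
  refine AnalyticAt.add (Finset.analyticAt_fun_sum _ fun j _ => ?_)
    (analyticAt_const.mul (key _ θ trivial))
  exact (key _ θ trivial).add (key _ θ trivial)

theorem analyticOnNhd_charFun {d : ℕ} (Q : Fin d → ℕ) (V : (Fin d → ℤ) → ℂ)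
    {x : (Fin d → ℝ) → ℂ} (hx : AnalyticOnNhd ℝ x Set.univ) :
    AnalyticOnNhd ℝ (fun θ => charFun Q V (multiplier Q θ) (x θ)) Set.univ := by
  intro θ _
  simp only [charFun, Matrix.det_apply']
  refine Finset.analyticAt_fun_sum _ fun σ _ => analyticAt_const.mul ?_
  refine Finset.analyticAt_fun_prod _ fun a _ => ?_
  simp only [Matrix.sub_apply, Matrix.scalar_apply, Matrix.diagonal_apply]
  refine AnalyticAt.sub ?_ (analyticOnNhd_floquetMatrix Q V _ _ θ trivial)
  split_ifs
  · exact hx θ trivial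
  · exact analyticAt_const

/-! ### Irreducibility of the free Bloch variety -/

/-- The distinct roots `μ a` are as many as the degree of the monic characteristic polynomial, so
they exhaust it. -/
theorem charFun_eq_prod {d : ℕ} {Q : Fin d → ℕ} (V : (Fin d → ℤ) → ℂ) {z : Fin d → ℂ}
    {μ : (∀ j, Fin (Q j)) → ℂ} (hμ : Function.Injective μ) (h : ∀ a, charFun Q V z (μ a) = 0)
    (x : ℂ) : charFun Q V z x = ∏ a, (x - μ a) := by
  have hdvd : ∏ a, (Polynomial.X - Polynomial.C (μ a)) ∣ (floquetMatrix Q V z).charpoly := by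
    refine Finset.prod_dvd_of_coprime ?_ fun a _ => ?_
    · intro a _ b _ hab
      exact Polynomial.isCoprime_X_sub_C_of_isUnit_sub (sub_ne_zero.2 (hμ.ne hab)).isUnit
    · rw [Polynomial.dvd_iff_isRoot, Polynomial.IsRoot, ← charFun_eq_eval, h]
  have heq : ∏ a, (Polynomial.X - Polynomial.C (μ a)) = (floquetMatrix Q V z).charpoly := by
    refine (Polynomial.eq_of_monic_of_dvd_of_natDegree_le
      (Polynomial.monic_prod_of_monic _ _ fun a _ => Polynomial.monic_X_sub_C _)
      (Matrix.charpoly_monic _) hdvd ?_).symm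
    rw [Matrix.charpoly_natDegree_eq_dim,
      Polynomial.natDegree_prod_of_monic _ _ fun a _ => Polynomial.monic_X_sub_C _]
    simp
  rw [charFun_eq_eval, ← heq, Polynomial.eval_prod]
  simp

theorem floquetIsospectral_zero_of_freeEigenvalue {d : ℕ} {Q : Fin d → ℕ} (hQ : ∀ j, 0 < Q j)
    {V : (Fin d → ℤ) → ℂ}
    (h : ∀ θ, charFun Q V (multiplier Q θ) (freeEigenvalue θ) = 0) :
    FloquetIsospectral Q V 0 := by
  rw [floquetIsospectral_iff]
  intro z hz x
  obtain ⟨θ₀, rfl⟩ := exists_multiplier_eq hQ hz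
  have han : ∀ p : (∀ j, Fin (Q j)) × (∀ j, Fin (Q j)), AnalyticOnNhd ℝ
      (fun θ => freeEigenvalue (θ + shift p.1) - freeEigenvalue (θ + shift p.2)) Set.univ := by
    have hs : ∀ a : ∀ j, Fin (Q j),
        AnalyticOnNhd ℝ (fun θ => freeEigenvalue (θ + shift a)) Set.univ := fun a θ _ =>
      (analyticOnNhd_freeEigenvalue _ trivial).fun_comp (analyticAt_id.add analyticAt_const)
    exact fun p θ _ => (hs _ θ trivial).sub (hs _ θ trivial)
  -- No factor vanishes identically, and analytic functions have no zero divisors, so this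
  -- discriminant is nonzero somewhere.
  have hdisc : ∀ s : Finset ((∀ j, Fin (Q j)) × (∀ j, Fin (Q j))), (∀ p ∈ s, p.1 ≠ p.2) →
      ∃ θ, ∏ p ∈ s, (freeEigenvalue (θ + shift p.1) - freeEigenvalue (θ + shift p.2)) ≠ 0 := by
    intro s
    induction s using Finset.induction_on with
    | empty => simp
    | insert p s hp ih =>
      intro hs
      by_contra! hzero
      simp_rw [Finset.prod_insert hp] at hzero
      rcases analyticOnNhd_eq_zero_or_eq_zero (han p)
        (fun θ _ => Finset.analyticAt_fun_prod s fun p _ => han p θ trivial) hzero with h1 | h1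
      · obtain ⟨θ, hθ⟩ := exists_freeEigenvalue_ne (hs p (Finset.mem_insert_self _ _))
        exact hθ (sub_eq_zero.1 (h1 θ))
      · obtain ⟨θ, hθ⟩ := ih fun q hq => hs q (Finset.mem_insert_of_mem hq)
        exact hθ (h1 θ)
  have hroot : ∀ U : (Fin d → ℤ) → ℂ,
      (∀ θ, charFun Q U (multiplier Q θ) (freeEigenvalue θ) = 0) →
      ∀ θ (a : ∀ j, Fin (Q j)), charFun Q U (multiplier Q θ) (freeEigenvalue (θ + shift a)) = 0 := by
    intro U hU θ a
    rw [← multiplier_add_shift hQ a, hU]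
  -- Where the discriminant is nonzero both characteristic functions have the same simple roots;
  -- hence discriminant times difference vanishes everywhere.
  have key := analyticOnNhd_eq_zero_or_eq_zero
    (f := fun θ => ∏ p : (∀ j, Fin (Q j)) × (∀ j, Fin (Q j)) with p.1 ≠ p.2,
      (freeEigenvalue (θ + shift p.1) - freeEigenvalue (θ + shift p.2)))
    (g := fun θ => charFun Q V (multiplier Q θ) x - charFun Q 0 (multiplier Q θ) x)
    (fun θ _ => Finset.analyticAt_fun_prod _ fun p _ => han p θ trivial)
    (fun θ _ => (analyticOnNhd_charFun Q V analyticOnNhd_const θ trivial).sub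
      (analyticOnNhd_charFun Q 0 analyticOnNhd_const θ trivial)) ?_
  · refine sub_eq_zero.1 (key.resolve_left (fun hzero => ?_) θ₀)
    obtain ⟨θ, hθ⟩ := hdisc {p | p.1 ≠ p.2} (by simp)
    exact hθ (hzero θ)
  · intro θ
    rw [mul_eq_zero, or_iff_not_imp_left]
    intro hne
    have hinj : Function.Injective fun a : ∀ j, Fin (Q j) => freeEigenvalue (θ + shift a) := by
      intro a b hab
      by_contra hne'
      exact Finset.prod_ne_zero_iff.1 hne (a, b) (by simpa using hne') (sub_eq_zero.2 hab)
    rw [charFun_eq_prod V hinj (hroot V h θ),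
      charFun_eq_prod 0 hinj (hroot 0 (charFun_zero_freeEigenvalue hQ) θ), sub_self]

theorem floquetIsospectral_zero_of_mul {d : ℕ} {Q : Fin d → ℕ} (hQ : ∀ j, 0 < Q j)
    {V V' : (Fin d → ℤ) → ℂ}
    (h : ∀ z : Fin d → ℂ, (∀ j, ‖z j‖ = 1) → ∀ x,
      charFun Q V z x * charFun Q V' z x = charFun Q 0 z x * charFun Q 0 z x) :
    FloquetIsospectral Q V 0 ∧ FloquetIsospectral Q V' 0 := by
  have cancel : ∀ {U U' : (Fin d → ℤ) → ℂ}, (∀ z : Fin d → ℂ, (∀ j, ‖z j‖ = 1) → ∀ x,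
      charFun Q U z x * charFun Q U' z x = charFun Q 0 z x * charFun Q 0 z x) →
      FloquetIsospectral Q U 0 → FloquetIsospectral Q U' 0 := by
    intro U U' hmul hU z hz
    rw [floquetSpectrum_eq_iff]
    have hU' := floquetSpectrum_eq_iff.1 (hU z hz)
    refine mul_left_cancel₀ (Matrix.charpoly_monic (floquetMatrix Q 0 z)).ne_zero ?_
    refine Polynomial.funext fun x => ?_
    have := hmul z hz x
    simp only [charFun_eq_eval, hU'] at this
    simpa using this
  have hmult : ∀ θ j, ‖multiplier Q θ j‖ = 1 := fun θ j => by
    rw [multiplier, norm_pow, norm_exp_ofReal_mul_I, one_pow]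
  rcases analyticOnNhd_eq_zero_or_eq_zero
    (analyticOnNhd_charFun Q V analyticOnNhd_freeEigenvalue)
    (analyticOnNhd_charFun Q V' analyticOnNhd_freeEigenvalue)
    (fun θ => by rw [h _ (hmult θ), charFun_zero_freeEigenvalue hQ, mul_zero]) with h1 | h1
  · have := floquetIsospectral_zero_of_freeEigenvalue hQ h1
    exact ⟨this, cancel h this⟩
  · have := floquetIsospectral_zero_of_freeEigenvalue hQ h1
    exact ⟨cancel (fun z hz x => by rw [mul_comm, h z hz x]) this, this⟩

end FloquetZd
namespace FloquetZd

/-! ### Splitting off the last coordinate -/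

/-- The factor of the Floquet basis functions that depends on one coordinate. -/
noncomputable def floquetFactor (r : ℕ) (w : ℂ) (l : Fin r) (m : ℤ) : ℂ :=
  if (r : ℤ) ∣ m - (((l : ℕ) : ℤ) + 1) then w ^ ((m - (((l : ℕ) : ℤ) + 1)) / (r : ℤ)) else 0

/-- The matrix entries of the free one-dimensional operator. -/
noncomputable def hopping (r : ℕ) (w : ℂ) (k l : Fin r) : ℂ :=
  floquetFactor r w l (((k : ℕ) : ℤ) + 1 + 1) + floquetFactor r w l (((k : ℕ) : ℤ) + 1 - 1)

theorem floquetBasis_eq_prod_floquetFactor {d : ℕ} (Q : Fin d → ℕ) (z : Fin d → ℂ)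
    (a : ∀ j, Fin (Q j)) (n : Fin d → ℤ) :
    floquetBasis Q z a n = ∏ j, floquetFactor (Q j) (z j) (a j) (n j) :=
  floquetBasis_eq_prod Q z a n

theorem floquetFactor_point {r : ℕ} (w : ℂ) (k l : Fin r) :
    floquetFactor r w l (((k : ℕ) : ℤ) + 1) = if k = l then 1 else 0 := by
  unfold floquetFactor
  by_cases h : k = l
  · simp [h]
  · rw [if_neg h, if_neg]
    intro hdvd
    have h3 := Int.eq_zero_of_abs_lt_dvd hdvd (by rw [abs_lt]; constructor <;> omega)
    exact h (Fin.ext (by omega))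

theorem floquetBasis_point {d : ℕ} (Q : Fin d → ℕ) (z : Fin d → ℂ) (a b : ∀ j, Fin (Q j)) :
    floquetBasis Q z b (point a) = if a = b then 1 else 0 := by
  simp_rw [floquetBasis_eq_prod_floquetFactor, point, floquetFactor_point,
    Finset.prod_ite_zero, Finset.prod_const_one, funext_iff, Finset.mem_univ, true_imp_iff]

/-- The fundamental domain as a product of the first coordinates and the last one. -/
def fundamentalDomainEquiv {d r : ℕ} {Q : Fin (d + 1) → ℕ} (hr : Q (Fin.last d) = r) :
    (∀ j : Fin d, Fin (Q j.castSucc)) × Fin r ≃ ∀ j, Fin (Q j) :=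
  (Equiv.prodComm _ _).trans
    (((finCongr hr.symm).prodCongr (Equiv.refl _)).trans (Fin.snocEquiv fun j => Fin (Q j)))

theorem point_fundamentalDomainEquiv {d r : ℕ} {Q : Fin (d + 1) → ℕ} (hr : Q (Fin.last d) = r)
    (a : ∀ j : Fin d, Fin (Q j.castSucc)) (k : Fin r) :
    point (fundamentalDomainEquiv hr (a, k)) =
      Fin.snoc (α := fun _ => ℤ) (point a) (((k : ℕ) : ℤ) + 1) := by
  funext j
  refine Fin.lastCases ?_ (fun j => ?_) j <;> simp [point, fundamentalDomainEquiv, Fin.snocEquiv]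

theorem floquetBasis_snoc {d r : ℕ} {Q : Fin (d + 1) → ℕ} (hr : Q (Fin.last d) = r)
    (z : Fin (d + 1) → ℂ) (b : ∀ j : Fin d, Fin (Q j.castSucc)) (l : Fin r) (n : Fin d → ℤ)
    (m : ℤ) :
    floquetBasis Q z (fundamentalDomainEquiv hr (b, l)) (Fin.snoc (α := fun _ => ℤ) n m) =
      floquetBasis (fun j => Q j.castSucc) (fun j => z j.castSucc) b n *
        floquetFactor r (z (Fin.last d)) l m := by
  subst hr
  simp [floquetBasis_eq_prod_floquetFactor, Fin.prod_univ_castSucc, fundamentalDomainEquiv,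
    Fin.snocEquiv]

theorem laplacian_snoc {d : ℕ} {u : (Fin (d + 1) → ℤ) → ℂ} {f : (Fin d → ℤ) → ℂ} {g : ℤ → ℂ}
    (hu : ∀ n m, u (Fin.snoc (α := fun _ => ℤ) n m) = f n * g m) (n : Fin d → ℤ) (m : ℤ) :
    laplacian u (Fin.snoc (α := fun _ => ℤ) n m) =
      laplacian f n * g m + f n * (g (m + 1) + g (m - 1)) := by
  have h1 : ∀ (j : Fin d) (t : ℤ), (Fin.snoc (α := fun _ => ℤ) n m : Fin (d + 1) → ℤ) +
      Pi.single j.castSucc t = Fin.snoc (α := fun _ => ℤ) (n + Pi.single j t) m := by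
    intro j t
    funext i
    refine Fin.lastCases ?_ (fun i => ?_) i <;> simp [Pi.single_apply]
  have h2 : ∀ t : ℤ, (Fin.snoc (α := fun _ => ℤ) n m : Fin (d + 1) → ℤ) +
      Pi.single (Fin.last d) t = Fin.snoc (α := fun _ => ℤ) n (m + t) := by
    intro t
    funext i
    refine Fin.lastCases ?_ (fun i => ?_) i <;> simp
  simp_rw [laplacian, Fin.sum_univ_castSucc, sub_eq_add_neg, ← Pi.single_neg, h1, h2, hu,
    ← add_mul, ← Finset.sum_mul, mul_add]

/-- Basis functions factor over coordinates, so the Laplacian becomes a Kronecker sum. -/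
theorem floquetMatrix_snoc {d r : ℕ} {Q : Fin (d + 1) → ℕ} (hr : Q (Fin.last d) = r)
    (V : (Fin (d + 1) → ℤ) → ℂ) (z : Fin (d + 1) → ℂ) (a b : ∀ j : Fin d, Fin (Q j.castSucc))
    (k l : Fin r) :
    floquetMatrix Q V z (fundamentalDomainEquiv hr (a, k)) (fundamentalDomainEquiv hr (b, l)) =
      (if k = l then floquetMatrix (fun j => Q j.castSucc)
        (fun n => V (Fin.snoc (α := fun _ => ℤ) n (((k : ℕ) : ℤ) + 1)))
        (fun j => z j.castSucc) a b else 0) +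
      if a = b then hopping r (z (Fin.last d)) k l else 0 := by
  simp only [floquetMatrix, Matrix.of_apply, schrodinger, point_fundamentalDomainEquiv,
    laplacian_snoc (floquetBasis_snoc hr z b l), floquetBasis_snoc]
  simp only [floquetFactor_point, floquetBasis_point, hopping]
  split_ifs <;> ring

theorem hopping_one (w : ℂ) : hopping 1 w 0 0 = w + w⁻¹ := by
  simp [hopping, floquetFactor]

theorem hopping_two (w : ℂ) : hopping 2 w 0 0 = 0 ∧ hopping 2 w 0 1 = 1 + w⁻¹ ∧
    hopping 2 w 1 0 = w + 1 ∧ hopping 2 w 1 1 = 0 := by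
  refine ⟨?_, ?_, ?_, ?_⟩ <;> norm_num [hopping, floquetFactor]

theorem charFun_of_last_eq_one {d : ℕ} {Q : Fin (d + 1) → ℕ} (hr : Q (Fin.last d) = 1)
    (V : (Fin (d + 1) → ℤ) → ℂ) (z : Fin (d + 1) → ℂ) (x : ℂ) :
    charFun Q V z x = charFun (fun j => Q j.castSucc)
      (fun n => V (Fin.snoc (α := fun _ => ℤ) n 1)) (fun j => z j.castSucc)
      (x - (z (Fin.last d) + (z (Fin.last d))⁻¹)) := by
  let e := (Equiv.prodUnique (∀ j : Fin d, Fin (Q j.castSucc)) (Fin 1)).symm.trans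
    (fundamentalDomainEquiv hr)
  have he : ∀ a, e a = fundamentalDomainEquiv hr (a, 0) := fun _ => rfl
  rw [charFun, charFun, ← Matrix.det_submatrix_equiv_self e]
  congr 1
  ext a b
  simp only [Matrix.submatrix_apply, Matrix.sub_apply, Matrix.scalar_apply, Matrix.diagonal_apply,
    e.injective.eq_iff]
  rw [he, he, floquetMatrix_snoc, hopping_one]
  simp only [if_true, Fin.val_zero, Nat.cast_zero, zero_add]
  split_ifs <;> ring

/-- Two copies of a type as a product with `Fin 2`. -/
def sumEquivProdFinTwo (α : Type*) : α ⊕ α ≃ α × Fin 2 where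
  toFun := Sum.elim (fun a => (a, 0)) fun a => (a, 1)
  invFun p := if p.2 = 0 then Sum.inl p.1 else Sum.inr p.1
  left_inv := by rintro (a | a) <;> simp
  right_inv := by
    rintro ⟨a, k⟩
    fin_cases k <;> simp

theorem charFun_of_last_eq_two {d : ℕ} {Q : Fin (d + 1) → ℕ} (hr : Q (Fin.last d) = 2)
    (V : (Fin (d + 1) → ℤ) → ℂ) (z : Fin (d + 1) → ℂ) (x : ℂ) :
    charFun Q V z x = (Matrix.fromBlocks
      (Matrix.scalar _ x - floquetMatrix (fun j => Q j.castSucc)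
        (fun n => V (Fin.snoc (α := fun _ => ℤ) n 1)) fun j => z j.castSucc)
      (Matrix.scalar _ (-(1 + (z (Fin.last d))⁻¹))) (Matrix.scalar _ (-(z (Fin.last d) + 1)))
      (Matrix.scalar _ x - floquetMatrix (fun j => Q j.castSucc)
        (fun n => V (Fin.snoc (α := fun _ => ℤ) n 2)) fun j => z j.castSucc)).det := by
  let e := (sumEquivProdFinTwo (∀ j : Fin d, Fin (Q j.castSucc))).trans (fundamentalDomainEquiv hr)
  have hl : ∀ a, e (Sum.inl a) = fundamentalDomainEquiv hr (a, 0) := fun _ => rfl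
  have hr' : ∀ a, e (Sum.inr a) = fundamentalDomainEquiv hr (a, 1) := fun _ => rfl
  obtain ⟨h00, h01, h10, h11⟩ := hopping_two (z (Fin.last d))
  rw [charFun, ← Matrix.det_submatrix_equiv_self e]
  congr 1
  ext (a | a) (b | b) <;>
  simp only [Matrix.submatrix_apply, Matrix.sub_apply, Matrix.scalar_apply, Matrix.diagonal_apply,
    Matrix.fromBlocks_apply₁₁, Matrix.fromBlocks_apply₁₂, Matrix.fromBlocks_apply₂₁,
    Matrix.fromBlocks_apply₂₂, hl, hr', floquetMatrix_snoc, h00, h01, h10, h11] <;>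
  split_ifs <;> simp_all

/-- `±s` are the eigenvalues of the 2×2 matrix with off-diagonal entries `b`, `c`. As scalars
commute with `M`, a unipotent conjugation makes the blocks triangular. -/
theorem det_fromBlocks_scalar {n R : Type*} [Fintype n] [DecidableEq n] [Field R]
    (M : Matrix n n R) {b c s : R} (hs : s * s = b * c) (hbc : c = 0 → b = 0) :
    (Matrix.fromBlocks M (Matrix.scalar n b) (Matrix.scalar n c) M).det =
      (M - Matrix.scalar n s).det * (M + Matrix.scalar n s).det := by
  by_cases hc : c = 0
  · have hs0 : s = 0 := by simpa [hc] using hs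
    simp [hc, hs0, hbc hc]
  · have hcs : ∀ t : R, M * Matrix.scalar n t = Matrix.scalar n t * M := fun t =>
      ((Matrix.scalar_commute t (fun _ => Commute.all _ _) M).eq).symm
    have key : Matrix.fromBlocks M (Matrix.scalar n b) (Matrix.scalar n c) M *
        Matrix.fromBlocks 1 (Matrix.scalar n (s / c)) 0 1 =
        Matrix.fromBlocks 1 (Matrix.scalar n (s / c)) 0 1 *
        Matrix.fromBlocks (M - Matrix.scalar n s) 0 (Matrix.scalar n c)
          (M + Matrix.scalar n s) := by
      simp only [Matrix.fromBlocks_multiply, mul_one, mul_zero, add_zero, one_mul, zero_mul,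
        zero_add, mul_add, hcs, ← map_mul]
      congr 1
      · rw [div_mul_cancel₀ _ hc, sub_add_cancel]
      · rw [add_right_inj]
        congr 1
        field_simp
        linear_combination -hs
      · rw [mul_div_cancel₀ _ hc, add_comm]
    have hdet := congrArg Matrix.det key
    simpa [Matrix.det_mul, Matrix.det_fromBlocks_zero₂₁, Matrix.det_fromBlocks_zero₁₂] using hdet

theorem charFun_of_last_eq_two_of_const {d : ℕ} {Q : Fin (d + 1) → ℕ} (hr : Q (Fin.last d) = 2)
    (W : (Fin d → ℤ) → ℂ) {z : Fin (d + 1) → ℂ} (hz : z (Fin.last d) ≠ 0) {s : ℂ}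
    (hs : s * s = (1 + (z (Fin.last d))⁻¹) * (z (Fin.last d) + 1)) (x : ℂ) :
    charFun Q (fun n => W fun j => n j.castSucc) z x =
      charFun (fun j => Q j.castSucc) W (fun j => z j.castSucc) (x - s) *
      charFun (fun j => Q j.castSucc) W (fun j => z j.castSucc) (x + s) := by
  rw [charFun_of_last_eq_two hr]
  simp only [Fin.snoc_castSucc]
  rw [det_fromBlocks_scalar (s := s) _ (by linear_combination hs)]
  · rw [charFun, charFun, map_sub, map_add, sub_right_comm, add_sub_right_comm]
  · intro h
    field_simp
    linear_combination h

theorem charFun_of_last_eq_two_of_neg_one {d : ℕ} {Q : Fin (d + 1) → ℕ}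
    (hr : Q (Fin.last d) = 2) (V : (Fin (d + 1) → ℤ) → ℂ) (z : Fin d → ℂ) (x : ℂ) :
    charFun Q V (Fin.snoc (α := fun _ => ℂ) z (-1)) x =
      charFun (fun j => Q j.castSucc) (fun n => V (Fin.snoc (α := fun _ => ℤ) n 1)) z x *
      charFun (fun j => Q j.castSucc) (fun n => V (Fin.snoc (α := fun _ => ℤ) n 2)) z x := by
  rw [charFun_of_last_eq_two hr]
  simp [inv_neg, Matrix.det_fromBlocks_zero₂₁, charFun]

/-! ### Reduction of the dimension -/

theorem isPeriodic_slice {d : ℕ} {Q : Fin (d + 1) → ℕ} {V : (Fin (d + 1) → ℤ) → ℂ}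
    (hV : IsPeriodic Q V) (m : ℤ) :
    IsPeriodic (fun j => Q j.castSucc) fun n => V (Fin.snoc (α := fun _ => ℤ) n m) := by
  intro n k hk
  beta_reduce
  rw [← hV (Fin.snoc (α := fun _ => ℤ) n m) (Fin.snoc (α := fun _ => ℤ) k 0)]
  · congr 1
    funext i
    refine Fin.lastCases ?_ (fun i => ?_) i <;> simp
  · intro j
    refine Fin.lastCases ?_ (fun i => ?_) j
    · simp
    · simpa using hk i

theorem eq_slice {d : ℕ} {Q : Fin (d + 1) → ℕ} {V : (Fin (d + 1) → ℤ) → ℂ}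
    (hV : IsPeriodic Q V) (n : Fin (d + 1) → ℤ) {m : ℤ}
    (hm : (Q (Fin.last d) : ℤ) ∣ m - n (Fin.last d)) :
    V n = V (Fin.snoc (α := fun _ => ℤ) (fun j => n j.castSucc) m) := by
  rw [← hV n (Pi.single (Fin.last d) (m - n (Fin.last d)))]
  · congr 1
    funext i
    refine Fin.lastCases ?_ (fun i => ?_) i <;> simp
  · intro j
    refine Fin.lastCases ?_ (fun i => ?_) j
    · simpa using hm
    · simp

theorem exists_isospectral_slice {d : ℕ} {Q : Fin (d + 1) → ℕ}
    (hQ : ∀ j : Fin d, 0 < Q j.castSucc) (hr : Q (Fin.last d) = 1 ∨ Q (Fin.last d) = 2)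
    {V : (Fin (d + 1) → ℤ) → ℂ} (hV : IsPeriodic Q V) (hne : V ≠ 0)
    (hiso : FloquetIsospectral Q V 0) :
    ∃ W : (Fin d → ℤ) → ℂ, IsPeriodic (fun j => Q j.castSucc) W ∧ W ≠ 0 ∧
      FloquetIsospectral (fun j => Q j.castSucc) W 0 := by
  obtain ⟨n, hn⟩ := Function.ne_iff.1 hne
  have hne_slice : ∀ m : ℤ, (Q (Fin.last d) : ℤ) ∣ m - n (Fin.last d) →
      (fun n => V (Fin.snoc (α := fun _ => ℤ) n m)) ≠ 0 := by
    intro m hm h0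
    exact hn ((eq_slice hV n hm).trans (congrFun h0 _))
  rw [floquetIsospectral_iff] at hiso
  have hiso' : ∀ (z : Fin d → ℂ) (w : ℂ), (∀ j, ‖z j‖ = 1) → ‖w‖ = 1 → ∀ x,
      charFun Q V (Fin.snoc (α := fun _ => ℂ) z w) x =
        charFun Q 0 (Fin.snoc (α := fun _ => ℂ) z w) x := by
    intro z w hz hw
    refine hiso _ fun j => ?_
    refine Fin.lastCases ?_ (fun i => ?_) j
    · simpa using hw
    · simpa using hz i
  rcases hr with hr | hr
  · refine ⟨_, isPeriodic_slice hV 1, hne_slice 1 (by simp [hr]), ?_⟩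
    rw [floquetIsospectral_iff]
    intro z hz x
    -- The argument is chosen to cancel the spectral shift at `w = 1`.
    have h := hiso' z 1 hz norm_one (x + (1 + 1⁻¹))
    rw [charFun_of_last_eq_one hr, charFun_of_last_eq_one hr] at h
    simp only [Fin.snoc_last, Fin.snoc_castSucc, add_sub_cancel_right] at h
    exact h
  · obtain ⟨h1, h2⟩ := floquetIsospectral_zero_of_mul (V := fun n => V (Fin.snoc n 1))
      (V' := fun n => V (Fin.snoc n 2)) hQ (by
        intro z hz x
        have h := hiso' z (-1) hz (by simp) x
        rw [charFun_of_last_eq_two_of_neg_one hr, charFun_of_last_eq_two_of_neg_one hr] at h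
        exact h)
    -- The parity of the last coordinate selects the slice, at height 1 or 2, that contains a
    -- translate of the point where `V` is nonzero.
    rcases Int.even_or_odd (n (Fin.last d)) with he | ho
    · exact ⟨_, isPeriodic_slice hV 2, hne_slice 2 (by obtain ⟨k, hk⟩ := he; rw [hr]; omega), h2⟩
    · exact ⟨_, isPeriodic_slice hV 1, hne_slice 1 (by obtain ⟨k, hk⟩ := ho; rw [hr]; omega), h1⟩

theorem exists_isospectral_extension {d : ℕ} {Q : Fin (d + 1) → ℕ}
    (hr : Q (Fin.last d) = 1 ∨ Q (Fin.last d) = 2) {W : (Fin d → ℤ) → ℂ}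
    (hW : IsPeriodic (fun j => Q j.castSucc) W) (hne : W ≠ 0)
    (hiso : FloquetIsospectral (fun j => Q j.castSucc) W 0) :
    ∃ V : (Fin (d + 1) → ℤ) → ℂ, IsPeriodic Q V ∧ V ≠ 0 ∧ FloquetIsospectral Q V 0 := by
  refine ⟨fun n => W fun j => n j.castSucc, fun n m hm => hW _ _ fun j => hm j.castSucc, ?_, ?_⟩
  · obtain ⟨n, hn⟩ := Function.ne_iff.1 hne
    refine Function.ne_iff.2 ⟨Fin.snoc (α := fun _ => ℤ) n 0, ?_⟩
    simpa using hn
  · rw [floquetIsospectral_iff] at hiso ⊢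
    intro z hz x
    have hiso' := hiso (fun j => z j.castSucc) fun j => hz j.castSucc
    rcases hr with hr | hr
    · rw [charFun_of_last_eq_one hr, charFun_of_last_eq_one hr]
      simp only [Fin.snoc_castSucc]
      exact hiso' _
    · have hw : z (Fin.last d) ≠ 0 := norm_ne_zero_iff.1 (by simp [hz])
      obtain ⟨s, hs⟩ := IsAlgClosed.exists_pow_nat_eq
        ((1 + (z (Fin.last d))⁻¹) * (z (Fin.last d) + 1)) two_pos
      rw [sq] at hs
      rw [charFun_of_last_eq_two_of_const hr W hw hs, hiso', hiso']
      exact (charFun_of_last_eq_two_of_const hr 0 hw hs x).symm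

end FloquetZd

theorem proposition4 (d : ℕ) (q : Fin d → ℕ) (hq : ∀ j, 0 < q j) (r : ℕ) (hr : r = 1 ∨ r = 2) :
    (∃ V : (Fin (d + 1) → ℤ) → ℂ,
        FloquetZd.IsPeriodic (Fin.snoc (α := fun _ => ℕ) q r) V ∧ V ≠ 0 ∧
          FloquetZd.FloquetIsospectral (Fin.snoc (α := fun _ => ℕ) q r) V 0) ↔
      (∃ W : (Fin d → ℤ) → ℂ,
        FloquetZd.IsPeriodic q W ∧ W ≠ 0 ∧ FloquetZd.FloquetIsospectral q W 0) := by
  -- An opaque `Q` lets `q` be replaced by `fun j => Q j.castSucc`, the form used in the reduction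
  -- lemmas.
  obtain ⟨Q, hQ⟩ : ∃ Q : Fin (d + 1) → ℕ, Q = Fin.snoc (α := fun _ => ℕ) q r := ⟨_, rfl⟩
  have hlast : Q (Fin.last d) = r := by simp [hQ]
  have hinit : (fun j : Fin d => Q j.castSucc) = q := by simp [hQ]
  rw [← hQ]
  subst hinit
  rw [← hlast] at hr
  exact ⟨fun ⟨V, hV, hne, hiso⟩ => FloquetZd.exists_isospectral_slice hq hr hV hne hiso,
    fun ⟨W, hW, hne, hiso⟩ => FloquetZd.exists_isospectral_extension hr hW hne hiso⟩
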